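/- Let $n\ge 4$ and let $|a\rangle,|a]\in\mathbb{C}^2$ ($a=1,\dots,n$) be spinors of $n$ massless four-dimensional momenta $k_a=|a\rangle|a]$ with $\sum_a k_a=0$. Write $\langle ab\rangle$, $[ab]$ for the antisymmetric spinor products, and $s_{ab}=2k_a\cdot k_b=-\langle ab\rangle[ab]$. A solution of the scattering equations is a tuple $\sigma=(\sigma_1,\dots,\sigma_n)$ of pairwise distinct complex numbers with $$\sum_{b\neq a}\frac{s_{ab}}{\sigma_{ab}}=0\quad(a=1,\dots,n),\qquad \sigma_{ab}=\sigma_a-\sigma_b ;$$ solutions are counted modulo Möbius transformations of the Riemann sphere. Assume the momenta are generic in the sense that every solution is nondegenerate, i.e. the Jacobian matrix $\Phi_{ab}=s_{ab}/\sigma_{ab}^2$ $(a\ne b)$, $\Phi_{aa}=-\sum_{c\neq a}s_{ac}/\sigma_{ac}^2$, has its maximal rank $n-3$ at every solution (equivalently $\det{}'\Phi(\sigma)\neq0$). Fix reference spinors $|p\rangle,|q]$ with $\langle ap\rangle\neq0$ and $[aq]\ne0$ for all $a$, and let $\mathfrak{C}_\pm(\sigma)$ be the $n\times n$ matrices $$(\mathfrak{C}_-)_{ab}=\frac{\langle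 ab\rangle}{\sigma_{ab}},\quad(\mathfrak{C}_+)_{ab}=\frac{[ab]}{\sigma_{ab}}\quad(a\neq b),\qquad(\mathfrak{C}_-)_{aa}=-\sum_{b\neq a}\frac{\langle ab\rangle[bq]}{\sigma_{ab}[aq]},\quad(\mathfrak{C}_+)_{aa}=-\sum_{b\neq a}\frac{[ab]\langle bp\rangle}{\sigma_{ab}\langle ap\rangle}.$$ Let $P_\pm(n-3,m)$ be the set of solutions $\sigma$ with $\operatorname{rank}\mathfrak{C}_\pm(\sigma)=m+1$. Then: 1. Every solution lies in $P_-(n-3,m)$ for some $0\le m\le n-4$, and for every $\sigma\in P_-(n-3,m)$ one has $m\le n-4$, $$\operatorname{rank}\mathfrak{C}_-(\sigma)=m+1,\qquad\operatorname{rank}\mathfrak{C}_+(\sigma)=n-m-3,$$ so the two ranks sum to $n-2$. 2. $P_+(n-3,n-k-4)=P_-(n-3,k)$ for all $0\le k\le n-4$. 3. If moreover all momenta $k_a$ are real (Minkowski signature), then for all $0\le k\le n-4$, with $P^*=\{\sigma^*:\sigma\in P\}$ the set of complex conjugates, $$P_+(n-3,n-k-4)=P_-^*(n-3,n-k-4)=P_-(n-3,k).$$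 Thus $P_-(n-3,k)$ and $P_-(n-3,n-k-4)$ are complex conjugates of each other, and they contain the same number of Möbius classes of solutions. -/

import Mathlib

noncomputable section

namespace CHY

/-- Angle bracket of two (undotted) spinors. -/
def angle (x y : Fin 2 → ℂ) : ℂ := x 0 * y 1 - x 1 * y 0

/-- Square bracket of two (dotted) spinors; the sign is such that `2 k_a · k_b = -⟨ab⟩[ab]`. -/
def square (x y : Fin 2 → ℂ) : ℂ := x 1 * y 0 - x 0 * y 1

/-- The four-vector `k` with `k⁰ + k³ = x₀ y₀`, `k¹ - i k² = x₀ y₁`, `k¹ + i k² = x₁ y₀`,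
`k⁰ - k³ = x₁ y₁`, i.e. the null momentum with spinors `x = |k⟩` and `y = |k]`. -/
def momentum (x y : Fin 2 → ℂ) : Fin 4 → ℂ :=
  ![(x 0 * y 0 + x 1 * y 1) / 2, (x 0 * y 1 + x 1 * y 0) / 2,
    Complex.I * (x 0 * y 1 - x 1 * y 0) / 2, (x 0 * y 0 - x 1 * y 1) / 2]

/-- The (complex bilinear) Minkowski product of signature `(+,-,-,-)`. -/
def minkowski (k l : Fin 4 → ℂ) : ℂ := k 0 * l 0 - k 1 * l 1 - k 2 * l 2 - k 3 * l 3

/-- Four-dimensional kinematics of `n` massless particles in spinor-helicity variables: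
`lam a = |a⟩`, `lamT a = |a]`, with conserved total momentum. -/
structure Kinematics (n : ℕ) where
  lam : Fin n → Fin 2 → ℂ
  lamT : Fin n → Fin 2 → ℂ
  conservation : ∑ a, momentum (lam a) (lamT a) = 0

variable {n : ℕ}

namespace Kinematics

/-- The momentum `k_a` of particle `a`. -/
def mom (K : Kinematics n) (a : Fin n) : Fin 4 → ℂ := momentum (K.lam a) (K.lamT a)

/-- The Mandelstam variables `s_ab = 2 k_a · k_b`. -/
def s (K : Kinematics n) (a b : Fin n) : ℂ := 2 * minkowski (K.mom a) (K.mom b)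

theorem s_eq (K : Kinematics n) (a b : Fin n) :
    K.s a b = -(angle (K.lam a) (K.lam b) * square (K.lamT a) (K.lamT b)) := by
  simp only [s, minkowski, mom, momentum, angle, square, Matrix.cons_val]
  linear_combination (-(1 / 2) * (K.lam a 0 * K.lamT a 1 - K.lam a 1 * K.lamT a 0) *
    (K.lam b 0 * K.lamT b 1 - K.lam b 1 * K.lamT b 0)) * Complex.I_mul_I

/-- All momenta are real vectors of Minkowski space. -/
def IsReal (K : Kinematics n) : Prop := ∀ a μ, (K.mom a μ).im = 0

/-- `σ` is a solution of the scattering equations: `n` pairwise distinct punctures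
with `∑_{b ≠ a} s_ab / (σ_a - σ_b) = 0` for every `a`. -/
def IsSolution (K : Kinematics n) (σ : Fin n → ℂ) : Prop :=
  Function.Injective σ ∧
    ∀ a, ∑ b ∈ Finset.univ.erase a, K.s a b / (σ a - σ b) = 0

/-- The Jacobian matrix `Φ_ab = ∂_{σ_b} ∑_{c ≠ a} s_ac / (σ_a - σ_c)` of the scattering
equations. -/
def Phi (K : Kinematics n) (σ : Fin n → ℂ) : Matrix (Fin n) (Fin n) ℂ :=
  Matrix.of fun a b =>
    if a = b then -∑ c ∈ Finset.univ.erase a, K.s a c / (σ a - σ c) ^ 2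
    else K.s a b / (σ a - σ b) ^ 2

/-- The solution `σ` is nondegenerate (`det' Φ(σ) ≠ 0`): the Jacobian matrix, which always
annihilates the three infinitesimal Möbius directions, has the maximal possible rank `n - 3`. -/
def IsNondegenerate (K : Kinematics n) (σ : Fin n → ℂ) : Prop := (K.Phi σ).rank + 3 = n

/-- The discriminant matrix `ℭ₋(σ)`, with reference spinor `|q]`. -/
def discMinus (K : Kinematics n) (q : Fin 2 → ℂ) (σ : Fin n → ℂ) : Matrix (Fin n) (Fin n) ℂ :=
  Matrix.of fun a b =>
    if a = b then
      -∑ c ∈ Finset.univ.erase a,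
        angle (K.lam a) (K.lam c) * square (K.lamT c) q /
          ((σ a - σ c) * square (K.lamT a) q)
    else angle (K.lam a) (K.lam b) / (σ a - σ b)

/-- The discriminant matrix `ℭ₊(σ)`, with reference spinor `|p⟩`. -/
def discPlus (K : Kinematics n) (p : Fin 2 → ℂ) (σ : Fin n → ℂ) : Matrix (Fin n) (Fin n) ℂ :=
  Matrix.of fun a b =>
    if a = b then
      -∑ c ∈ Finset.univ.erase a,
        square (K.lamT a) (K.lamT c) * angle (K.lam c) p /
          ((σ a - σ c) * angle (K.lam a) p)
    else square (K.lamT a) (K.lamT b) / (σ a - σ b)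

/-- The class `P₋(n-3, m)`: solutions with `rank ℭ₋ = m + 1`. -/
def PMinus (K : Kinematics n) (q : Fin 2 → ℂ) (m : ℕ) : Set (Fin n → ℂ) :=
  {σ | K.IsSolution σ ∧ (K.discMinus q σ).rank = m + 1}

/-- The class `P₊(n-3, m)`: solutions with `rank ℭ₊ = m + 1`. -/
def PPlus (K : Kinematics n) (p : Fin 2 → ℂ) (m : ℕ) : Set (Fin n → ℂ) :=
  {σ | K.IsSolution σ ∧ (K.discPlus p σ).rank = m + 1}

end Kinematics

/-- The set `P*` of complex conjugates `σ* = (σ̄_1, …, σ̄_n)` of the members of `P`. -/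
def conjSet (P : Set (Fin n → ℂ)) : Set (Fin n → ℂ) :=
  (fun σ a => (starRingEnd ℂ) (σ a)) '' P

/-- Two puncture configurations are equivalent if a Möbius transformation of the Riemann sphere
`OnePoint ℂ` carries one to the other. -/
def mobiusSetoid (n : ℕ) : Setoid (Fin n → ℂ) where
  r σ τ := ∃ g : GL (Fin 2) ℂ, ∀ a, g • (σ a : OnePoint ℂ) = (τ a : OnePoint ℂ)
  iseqv :=
    { refl := fun _ => ⟨1, fun _ => one_smul _ _⟩
      symm := fun ⟨g, hg⟩ => ⟨g⁻¹, fun a => by rw [← hg a, inv_smul_smul]⟩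
      trans := fun ⟨g, hg⟩ ⟨h, hh⟩ => ⟨h * g, fun a => by rw [mul_smul, hg a, hh a]⟩ }

/-- The set of Möbius classes of a set of puncture configurations. -/
def mobiusClasses (P : Set (Fin n → ℂ)) : Set (Quotient (mobiusSetoid n)) :=
  Quotient.mk (mobiusSetoid n) '' P

end CHY

end

/-! Put the residues `k_a = |a⟩|a]` into the `2 × 2` polynomial matrix `P(z) = ∏ (z - σ_a) ∑ k_a /
(z - σ_a)`. The scattering equations make `det P` vanish, so `P` is a column `L` times a row `N`,
where `L` can be taken coprime. Momentum conservation bounds the degrees of the entries of `P` by `n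
- 2`.

Nondegeneracy makes `N` coprime and the bound sharp. A zero of `P` at a finite point off the
punctures, or an extra zero at infinity, would add `1 / (z - σ_a)` or `σ_a³` to the kernel of `Φ`,
which is spanned by `1, σ, σ²`. Hence `deg L + deg N = n - 2`, where the degree of a pair is the
larger one.

Taking residues, `|a⟩ = t_a L(σ_a)`. Thus `ℭ₋` is, up to the invertible diagonal `t` on both sides,
the Bezoutian of `L` sampled at the punctures, and its rank is `deg L` (`rank_of_bezoutian`,
`rank_discriminant`). Likewise `rank ℭ₊ = deg N`, so the ranks add up to `n - 2` and do not depend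
on the reference spinors (`exists_ranks`). For real momenta `|a]` is a real multiple of the
conjugate of `|a⟩`, so conjugating `σ` exchanges the two matrices. -/

namespace CHY

open Polynomial Lagrange

/-! ### Polynomials with prescribed residues at the punctures. -/

section ResiduePoly

variable {F : Type*} [Field F] {n : ℕ}

/-- The numerator of `∑ a, c a / (z - σ a)` over the denominator `∏ a, (z - σ a)`. -/
noncomputable def residuePoly (σ : Fin n → F) (c : Fin n → F) : F[X] :=
  ∑ a, C (c a) * nodal (Finset.univ.erase a) σ

/-- The product of the differences `σ a - σ b` over all `b ≠ a`. -/
noncomputable def nodeWeight (σ : Fin n → F) (a : Fin n) : F :=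
  (nodal (Finset.univ.erase a) σ).eval (σ a)

theorem nodeWeight_ne_zero {σ : Fin n → F} (hσ : Function.Injective σ) (a : Fin n) :
    nodeWeight σ a ≠ 0 :=
  eval_nodal_not_at_node fun _ hb h => (Finset.mem_erase.mp hb).1 (hσ h).symm

theorem residuePoly_eval_node (σ c : Fin n → F) (a : Fin n) :
    (residuePoly σ c).eval (σ a) = c a * nodeWeight σ a := by
  rw [residuePoly, eval_finsetSum, Finset.sum_eq_single a]
  · simp [nodeWeight]
  · intro b _ hb
    rw [eval_mul, eval_nodal_at_node (Finset.mem_erase.mpr ⟨hb.symm, Finset.mem_univ a⟩), mul_zero]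
  · simp

theorem residuePoly_eval_of_ne (σ c : Fin n → F) {z : F} (hz : ∀ a, z ≠ σ a) :
    (residuePoly σ c).eval z = (nodal Finset.univ σ).eval z * ∑ a, c a / (z - σ a) := by
  rw [residuePoly, eval_finsetSum, Finset.mul_sum]
  refine Finset.sum_congr rfl fun a _ => ?_
  rw [nodal_eq_mul_nodal_erase (Finset.mem_univ a)]
  have := sub_ne_zero.mpr (hz a)
  simp only [eval_mul, eval_C, eval_sub, eval_X]
  field_simp

theorem residuePoly_degree_lt (σ c : Fin n → F) : (residuePoly σ c).degree < n := by
  rw [← mem_degreeLT]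
  refine Submodule.sum_mem _ fun a _ => ?_
  rw [← smul_eq_C_mul]
  refine Submodule.smul_mem _ _ ?_
  rw [mem_degreeLT, degree_nodal]
  have := Finset.card_erase_lt_of_mem (Finset.mem_univ a)
  rw [Finset.card_univ, Fintype.card_fin] at this
  exact_mod_cast this

theorem residuePoly_coeff (σ c : Fin n → F) : (residuePoly σ c).coeff (n - 1) = ∑ a, c a := by
  rw [residuePoly, finsetSum_coeff]
  refine Finset.sum_congr rfl fun a _ => ?_
  have h : (nodal (Finset.univ.erase a) σ).natDegree = n - 1 := by
    rw [natDegree_nodal, Finset.card_erase_of_mem (Finset.mem_univ a), Finset.card_univ,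
      Fintype.card_fin]
  rw [coeff_C_mul, ← h, coeff_natDegree, nodal_monic.leadingCoeff, mul_one]

/-- Since `z / (z - σ_a) = 1 + σ_a / (z - σ_a)`, the correction is `∑ c_a` times the nodal
polynomial. Applied to conserved momenta, this lowers the degree bound by one and identifies the
next coefficient with the first moment. -/
theorem X_mul_residuePoly (σ c : Fin n → F) (hc : ∑ a, c a = 0) :
    X * residuePoly σ c = residuePoly σ (fun a => σ a * c a) := by
  have h : ∀ a, X * (C (c a) * nodal (Finset.univ.erase a) σ) =
      C (σ a * c a) * nodal (Finset.univ.erase a) σ + C (c a) * nodal Finset.univ σ := fun a => by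
    rw [nodal_eq_mul_nodal_erase (Finset.mem_univ a), C_mul]
    ring
  rw [residuePoly, Finset.mul_sum, Finset.sum_congr rfl fun a _ => h a, Finset.sum_add_distrib,
    ← Finset.sum_mul, ← map_sum, hc, map_zero, zero_mul, add_zero, residuePoly]

theorem eq_of_eval_node_eq {σ : Fin n → F} (hσ : Function.Injective σ) {f g : F[X]}
    (hf : f.degree < n) (hg : g.degree < n) (h : ∀ a, f.eval (σ a) = g.eval (σ a)) : f = g :=
  eq_of_degrees_lt_of_eval_index_eq Finset.univ hσ.injOn (by simpa using hf) (by simpa using hg)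
    fun a _ => h a

theorem residuePoly_natDegree_le {σ c : Fin n → F} (hc : ∑ a, c a = 0) :
    (residuePoly σ c).natDegree ≤ n - 2 := by
  by_cases h0 : residuePoly σ c = 0
  · simp [h0]
  have h1 := residuePoly_degree_lt σ (fun a => σ a * c a)
  rw [← X_mul_residuePoly σ c hc, ← natDegree_lt_iff_degree_lt (mul_ne_zero X_ne_zero h0),
    natDegree_X_mul h0] at h1
  omega

theorem residuePoly_coeff_of_sum_eq_zero (hn : 2 ≤ n) {σ c : Fin n → F} (hc : ∑ a, c a = 0) :
    (residuePoly σ c).coeff (n - 2) = ∑ a, σ a * c a := by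
  rw [← residuePoly_coeff σ, ← X_mul_residuePoly σ c hc, show n - 1 = n - 2 + 1 by omega,
    coeff_X_mul]

end ResiduePoly

/-! ### Kernel and rank of a Bezoutian sampled at the punctures. -/

section Bezoutian

variable {F : Type*} [Field F] {n : ℕ}

/-- The Bezoutian `(L₀(z) L₁(x) - L₁(z) L₀(x)) / (z - x)` as a polynomial in `z`. -/
noncomputable def bezoutian (L : Fin 2 → F[X]) (x : F) : F[X] :=
  (L 0 * C ((L 1).eval x) - L 1 * C ((L 0).eval x)) /ₘ (X - C x)

theorem X_sub_C_mul_bezoutian (L : Fin 2 → F[X]) (x : F) :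
    (X - C x) * bezoutian L x = L 0 * C ((L 1).eval x) - L 1 * C ((L 0).eval x) :=
  mul_divByMonic_eq_iff_isRoot.mpr (by simp [IsRoot.def, mul_comm])

theorem bezoutian_eval (L : Fin 2 → F[X]) {x z : F} (h : z ≠ x) :
    (bezoutian L x).eval z =
      ((L 0).eval z * (L 1).eval x - (L 1).eval z * (L 0).eval x) / (z - x) := by
  rw [eq_div_iff (sub_ne_zero.mpr h), mul_comm]
  simpa using congrArg (eval z) (X_sub_C_mul_bezoutian L x)

theorem bezoutian_degree_lt (L : Fin 2 → F[X]) (hL : ∀ i, (L i).natDegree < n) (x : F) :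
    (bezoutian L x).degree < n := by
  refine lt_of_le_of_lt (degree_divByMonic_le _ _) ?_
  have hd : ∀ i y, L i * C y ∈ degreeLT F n := fun i y => by
    rw [mul_comm, ← smul_eq_C_mul]
    refine Submodule.smul_mem _ _ (mem_degreeLT.mpr ?_)
    exact lt_of_le_of_lt degree_le_natDegree (by exact_mod_cast hL i)
  exact mem_degreeLT.mp (Submodule.sub_mem _ (hd 0 _) (hd 1 _))

theorem nodal_mul_sum_bezoutian (L : Fin 2 → F[X]) (σ w : Fin n → F) :
    nodal Finset.univ σ * ∑ b, C (w b) * bezoutian L (σ b) =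
      L 0 * residuePoly σ (fun b => w b * (L 1).eval (σ b)) -
        L 1 * residuePoly σ (fun b => w b * (L 0).eval (σ b)) := by
  rw [residuePoly, residuePoly, Finset.mul_sum, Finset.mul_sum, Finset.mul_sum,
    ← Finset.sum_sub_distrib]
  refine Finset.sum_congr rfl fun b _ => ?_
  rw [nodal_eq_mul_nodal_erase (Finset.mem_univ b), C_mul, C_mul]
  linear_combination (C (w b) * nodal (Finset.univ.erase b) σ) * X_sub_C_mul_bezoutian L (σ b)

/-- The weighted sum of Bezoutians has degree below `n`, so vanishing at all `n` nodes is vanishing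
identically. Clearing the denominators `z - σ_b` then separates `L(z)` from the sampled values
`L(σ_b)`. -/
theorem sum_bezoutian_eq_zero_iff {σ : Fin n → F} (hσ : Function.Injective σ) (L : Fin 2 → F[X])
    (hL : ∀ i, (L i).natDegree < n) (w : Fin n → F) :
    (∀ a, ∑ b, w b * (bezoutian L (σ b)).eval (σ a) = 0) ↔
      L 0 * residuePoly σ (fun b => w b * (L 1).eval (σ b)) =
        L 1 * residuePoly σ (fun b => w b * (L 0).eval (σ b)) := by
  rw [← sub_eq_zero, ← nodal_mul_sum_bezoutian, mul_eq_zero, or_iff_right nodal_ne_zero]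
  constructor
  · intro h
    refine eq_of_eval_node_eq hσ ?_ (by simp) fun a => ?_
    · refine mem_degreeLT.mp (Submodule.sum_mem _ fun b _ => ?_)
      rw [← smul_eq_C_mul]
      exact Submodule.smul_mem _ _ (mem_degreeLT.mpr (bezoutian_degree_lt L hL _))
    · simpa [eval_finsetSum] using h a
  · intro h a
    simpa [eval_finsetSum] using congrArg (eval (σ a)) h

/-- Two proportional pairs of polynomials: if `L` is coprime, the other is a multiple of it. -/
theorem exists_eq_mul_of_isCoprime {L Q : Fin 2 → F[X]} (hL : IsCoprime (L 0) (L 1))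
    (h : L 0 * Q 1 = L 1 * Q 0) : ∃ f, ∀ i, Q i = L i * f := by
  obtain ⟨u, v, huv⟩ := hL
  refine ⟨u * Q 0 + v * Q 1, Fin.forall_fin_two.mpr ⟨?_, ?_⟩⟩
  · linear_combination (-Q 0) * huv - v * h
  · linear_combination (-Q 1) * huv + u * h

/-- The kernel of the Bezoutian matrix consists of the weights `h(σ a) / ∏ (σ a - σ b)` with
`deg h < n - d`. -/
theorem rank_of_bezoutian {σ t : Fin n → F} (hσ : Function.Injective σ) (ht : ∀ a, t a ≠ 0)
    {L : Fin 2 → F[X]} (hL : IsCoprime (L 0) (L 1)) {d : ℕ} (hd : d < n)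
    (hLd : ∀ i, (L i).natDegree ≤ d) (hd' : ∃ i, (L i).natDegree = d)
    {M : Matrix (Fin n) (Fin n) F}
    (hM : ∀ a b, M a b = t a * (t b * (bezoutian L (σ b)).eval (σ a))) : M.rank = d := by
  have hw := nodeWeight_ne_zero hσ
  have hLe : ∀ a, ∃ i, (L i).eval (σ a) ≠ 0 := by
    intro a
    by_contra! h
    obtain ⟨u, v, huv⟩ := hL
    simpa [h] using congrArg (eval (σ a)) huv
  have hker : ∀ w, M.mulVec w = 0 ↔
      L 0 * residuePoly σ (fun b => t b * w b * (L 1).eval (σ b)) =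
        L 1 * residuePoly σ (fun b => t b * w b * (L 0).eval (σ b)) := by
    intro w
    rw [← sum_bezoutian_eq_zero_iff hσ L (fun i => (hLd i).trans_lt hd), funext_iff]
    refine forall_congr' fun a => ?_
    have : M.mulVec w a = t a * ∑ b, t b * w b * (bezoutian L (σ b)).eval (σ a) := by
      rw [Matrix.mulVec, dotProduct, Finset.mul_sum]
      refine Finset.sum_congr rfl fun b _ => ?_
      rw [hM]
      ring
    rw [this, Pi.zero_apply, mul_eq_zero, or_iff_right (ht a)]
  -- The weights are chosen so that `t_b * Ψ f b * L_i(σ_b)` are the residues of `L_i f / ∏ (z -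
  -- σ_a)`. The kernel equation then says that both components share the same cofactor `f`.
  let Ψ : F[X] →ₗ[F] (Fin n → F) := LinearMap.pi fun a =>
    ((t a)⁻¹ * (nodeWeight σ a)⁻¹) • Polynomial.leval (σ a)
  have hΨ : ∀ f a, Ψ f a = (t a)⁻¹ * (nodeWeight σ a)⁻¹ * f.eval (σ a) := fun f a => by
    simp [Ψ]
  have hinj : Function.Injective (Ψ.domRestrict (degreeLT F (n - d))) := by
    rintro ⟨f, hf⟩ ⟨g, hg⟩ h
    have hlt : ∀ {f : F[X]}, f ∈ degreeLT F (n - d) → f.degree < n := fun hf =>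
      (mem_degreeLT.mp hf).trans_le (by exact_mod_cast Nat.sub_le n d)
    refine Subtype.ext (eq_of_eval_node_eq hσ (hlt hf) (hlt hg) fun a => ?_)
    have := congrFun h a
    simp only [LinearMap.domRestrict_apply, hΨ] at this
    exact mul_left_cancel₀ (mul_ne_zero (inv_ne_zero (ht a)) (inv_ne_zero (hw a))) this
  have hrange : LinearMap.range (Ψ.domRestrict (degreeLT F (n - d))) =
      LinearMap.ker M.mulVecLin := by
    ext w
    rw [LinearMap.mem_ker, Matrix.mulVecLin_apply, hker]
    constructor
    · rintro ⟨⟨f, hf⟩, rfl⟩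
      have key : ∀ i, residuePoly σ (fun b => t b * Ψ f b * (L i).eval (σ b)) = L i * f := by
        intro i
        refine eq_of_eval_node_eq hσ (residuePoly_degree_lt _ _) ?_ fun a => ?_
        · by_cases hf0 : f = 0
          · simp [hf0]
          have h1 := mem_degreeLT.mp hf
          rw [← natDegree_lt_iff_degree_lt hf0] at h1
          refine degree_le_natDegree.trans_lt ?_
          have h2 := natDegree_mul_le (p := L i) (q := f)
          have h3 := hLd i
          exact_mod_cast (by omega : (L i * f).natDegree < n)
        · rw [residuePoly_eval_node, hΨ, eval_mul]
          have := ht a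
          have := hw a
          field_simp
      simp only [LinearMap.domRestrict_apply, key]
      ring
    · intro h
      obtain ⟨f, hf⟩ := exists_eq_mul_of_isCoprime
        (Q := fun i => residuePoly σ (fun b => t b * w b * (L i).eval (σ b))) hL h
      have hfd : f ∈ degreeLT F (n - d) := by
        rw [mem_degreeLT]
        by_cases hf0 : f = 0
        · rw [hf0, degree_zero]
          exact WithBot.bot_lt_coe _
        obtain ⟨i, hi⟩ := hd'
        rw [← natDegree_lt_iff_degree_lt hf0]
        have h1 := residuePoly_degree_lt σ (fun b => t b * w b * (L i).eval (σ b))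
        rw [hf i] at h1
        -- As `natDegree 0 = 0`, a zero component attains `d` only if `d = 0`; the other component
        -- then bounds the degree of `f`.
        by_cases hLi : L i = 0
        · have hd0 : d = 0 := by rw [← hi, hLi, natDegree_zero]
          obtain ⟨j, hj⟩ : ∃ j, L j ≠ 0 := by
            obtain ⟨j, hj⟩ := hLe ⟨0, by omega⟩
            exact ⟨j, fun h => hj (by rw [h, eval_zero])⟩
          have h2 := residuePoly_degree_lt σ (fun b => t b * w b * (L j).eval (σ b))
          rw [hf j, ← natDegree_lt_iff_degree_lt (mul_ne_zero hj hf0), natDegree_mul hj hf0] at h2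
          omega
        · rw [← natDegree_lt_iff_degree_lt (mul_ne_zero hLi hf0), natDegree_mul hLi hf0, hi] at h1
          omega
      refine ⟨⟨f, hfd⟩, funext fun a => ?_⟩
      obtain ⟨i, hi⟩ := hLe a
      have h1 := congrArg (eval (σ a)) (hf i)
      rw [residuePoly_eval_node, eval_mul] at h1
      rw [LinearMap.domRestrict_apply, hΨ]
      have h2 : f.eval (σ a) = t a * w a * nodeWeight σ a :=
        mul_left_cancel₀ hi (by linear_combination -h1)
      rw [h2]
      have := ht a
      have := hw a
      field_simp
  have h1 := LinearMap.finrank_range_of_inj hinj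
  rw [hrange, LinearEquiv.finrank_eq (degreeLTEquiv F (n - d)), Module.finrank_fin_fun] at h1
  have h2 := LinearMap.finrank_range_add_finrank_ker M.mulVecLin
  rw [h1, Module.finrank_fin_fun] at h2
  rw [Matrix.rank]
  omega

end Bezoutian

/-! ### Discriminant matrices as Bezoutians. -/

section Discriminant

variable {n : ℕ}

/-- Contracting `L N` with `q` leaves `L f`, and its values at the punctures give `x_a = t_a
L(σ_a)`. Off the diagonal the bracket over `σ_ab` is then a rescaled Bezoutian. Stated for general
`x, y` so as to serve both matrices. -/
theorem rank_discriminant {σ : Fin n → ℂ} (hσ : Function.Injective σ) {x y : Fin n → Fin 2 → ℂ}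
    {L N : Fin 2 → ℂ[X]} (hL : IsCoprime (L 0) (L 1))
    (hLN : ∀ i j, residuePoly σ (fun a => x a i * y a j) = L i * N j)
    {d : ℕ} (hd : d < n) (hLd : ∀ i, (L i).natDegree ≤ d) (hd' : ∃ i, (L i).natDegree = d)
    (hx : ∀ a, ∃ i, x a i ≠ 0) {q : Fin 2 → ℂ} (hq : ∀ a, square (y a) q ≠ 0)
    {M : Matrix (Fin n) (Fin n) ℂ}
    (hM : ∀ a b, M a b = if a = b then
      -∑ c ∈ Finset.univ.erase a,
        angle (x a) (x c) * square (y c) q / ((σ a - σ c) * square (y a) q)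
      else angle (x a) (x b) / (σ a - σ b)) : M.rank = d := by
  have hw := nodeWeight_ne_zero hσ
  set f : ℂ[X] := N 1 * C (q 0) - N 0 * C (q 1) with hf
  have hLf : ∀ i, residuePoly σ (fun a => x a i * square (y a) q) = L i * f := by
    intro i
    rw [hf, mul_sub, ← mul_assoc, ← mul_assoc, ← hLN, ← hLN, residuePoly, residuePoly, residuePoly,
      Finset.sum_mul, Finset.sum_mul, ← Finset.sum_sub_distrib]
    refine Finset.sum_congr rfl fun a _ => ?_
    simp only [square, C_mul, C_sub]
    ring
  have hev : ∀ a i, x a i * square (y a) q * nodeWeight σ a =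
      (L i).eval (σ a) * f.eval (σ a) := fun a i => by
    rw [← eval_mul, ← hLf, residuePoly_eval_node]
  set t : Fin n → ℂ := fun a => f.eval (σ a) / (square (y a) q * nodeWeight σ a) with ht
  have hxt : ∀ a i, x a i = t a * (L i).eval (σ a) := fun a i => by
    have h1 := hq a
    have h2 := hw a
    rw [ht]
    field_simp
    linear_combination hev a i
  have ht0 : ∀ a, t a ≠ 0 := fun a h => by
    obtain ⟨i, hi⟩ := hx a
    exact hi (by rw [hxt, h, zero_mul])
  -- The weights `[bq] t_b` lie in the kernel of the sampled Bezoutian. Solving row `a` of this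
  -- relation for its diagonal term gives exactly the prescribed diagonal of `M`.
  have hbez := (sum_bezoutian_eq_zero_iff hσ L (fun i => (hLd i).trans_lt hd)
    (fun b => square (y b) q * t b)).mpr (by
      have : ∀ i, (fun b => square (y b) q * t b * (L i).eval (σ b)) =
          fun b => x b i * square (y b) q := fun i => funext fun b => by
        rw [hxt]
        ring
      rw [this, this, hLf, hLf]
      ring)
  have hoff : ∀ a b, a ≠ b →
      angle (x a) (x b) / (σ a - σ b) = t a * (t b * (bezoutian L (σ b)).eval (σ a)) := by
    intro a b hab
    rw [bezoutian_eval L (hσ.ne hab), angle, hxt a, hxt a, hxt b, hxt b]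
    ring
  refine rank_of_bezoutian hσ ht0 hL hd hLd hd' fun a b => ?_
  rw [hM]
  split_ifs with hab
  · subst hab
    have h1 := hbez a
    rw [← Finset.add_sum_erase _ _ (Finset.mem_univ a)] at h1
    have h2 : ∀ c ∈ Finset.univ.erase a,
        angle (x a) (x c) * square (y c) q / ((σ a - σ c) * square (y a) q) =
          t a / square (y a) q *
            (square (y c) q * t c * (bezoutian L (σ c)).eval (σ a)) := by
      intro c hc
      have := hoff a c (Finset.ne_of_mem_erase hc).symm
      rw [mul_div_mul_comm, this]
      ring
    rw [Finset.sum_congr rfl h2, ← Finset.mul_sum, eq_neg_of_add_eq_zero_right h1]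
    have := hq a
    field_simp
  · exact hoff a b hab

end Discriminant

/-! ### The scattering equations as vanishing of a determinant. -/

namespace Kinematics

variable {n : ℕ}

theorem sum_lam_mul_lamT (K : Kinematics n) (i j : Fin 2) :
    ∑ a, K.lam a i * K.lamT a j = 0 := by
  have h : ∀ μ, ∑ a, momentum (K.lam a) (K.lamT a) μ = 0 := fun μ => by
    simpa using congrFun K.conservation μ
  have h0 := h 0
  have h1 := h 1
  have h2 := h 2
  have h3 := h 3
  simp only [momentum, Matrix.cons_val, ← Finset.sum_div, Finset.sum_add_distrib,
    Finset.sum_sub_distrib, ← Finset.mul_sum] at h0 h1 h2 h3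
  fin_cases i <;> fin_cases j <;> simp only [Fin.zero_eta, Fin.mk_one, Fin.isValue]
  · linear_combination h0 + h3
  · linear_combination h1 - Complex.I * h2 + (1 / 2) * (∑ a, K.lam a 0 * K.lamT a 1 -
      ∑ a, K.lam a 1 * K.lamT a 0) * Complex.I_sq
  · linear_combination h1 + Complex.I * h2 - (1 / 2) * (∑ a, K.lam a 0 * K.lamT a 1 -
      ∑ a, K.lam a 1 * K.lamT a 0) * Complex.I_sq
  · linear_combination h0 - h3

theorem s_symm (K : Kinematics n) (a b : Fin n) : K.s a b = K.s b a := by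
  simp only [s_eq, angle, square]
  ring

theorem s_self (K : Kinematics n) (a : Fin n) : K.s a a = 0 := by
  simp only [s_eq, angle, square]
  ring

/-- `s_ab` is linear in the bispinor of `k_b`, so linear relations among momenta pass to the
Mandelstam variables. -/
theorem sum_s_eq_zero (K : Kinematics n) {c : Fin n → ℂ}
    (h : ∀ i j, ∑ b, c b * (K.lam b i * K.lamT b j) = 0) (a : Fin n) :
    ∑ b, c b * K.s a b = 0 := by
  have : ∀ b, c b * K.s a b =
      -(K.lam a 0 * K.lamT a 1) * (c b * (K.lam b 1 * K.lamT b 0)) +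
      K.lam a 0 * K.lamT a 0 * (c b * (K.lam b 1 * K.lamT b 1)) +
      K.lam a 1 * K.lamT a 1 * (c b * (K.lam b 0 * K.lamT b 0)) +
      -(K.lam a 1 * K.lamT a 0) * (c b * (K.lam b 0 * K.lamT b 1)) := fun b => by
    simp only [s_eq, angle, square]
    ring
  simp only [this, Finset.sum_add_distrib, ← Finset.mul_sum, h, mul_zero, add_zero]

theorem IsSolution.sum_eq_zero {K : Kinematics n} {σ : Fin n → ℂ} (h : K.IsSolution σ)
    (a : Fin n) : ∑ b, K.s a b / (σ a - σ b) = 0 := by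
  rw [← Finset.add_sum_erase _ _ (Finset.mem_univ a), h.2 a, sub_self, div_zero, add_zero]

/-- The `2 × 2` matrix of polynomials `∏ (z - σ_a) ∑ k_a / (z - σ_a)`. -/
noncomputable def momentumPoly (K : Kinematics n) (σ : Fin n → ℂ) (i j : Fin 2) : ℂ[X] :=
  residuePoly σ fun a => K.lam a i * K.lamT a j

/-- The determinant is the Minkowski square of `∑ k_a / (z - σ_a)`, that is, half of `∑ s_ab / ((z -
σ_a)(z - σ_b))`. Partial fractions turn this sum into a combination of the scattering equations. -/
theorem IsSolution.det_eval_eq_zero {K : Kinematics n} {σ : Fin n → ℂ} (h : K.IsSolution σ)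
    {z : ℂ} (hz : ∀ a, z ≠ σ a) :
    (∑ a, K.lam a 0 * K.lamT a 0 / (z - σ a)) * (∑ a, K.lam a 1 * K.lamT a 1 / (z - σ a)) -
      (∑ a, K.lam a 0 * K.lamT a 1 / (z - σ a)) *
        (∑ a, K.lam a 1 * K.lamT a 0 / (z - σ a)) = 0 := by
  have hs : ∑ a, ∑ b, K.s a b / ((z - σ a) * (z - σ b)) = 0 := by
    have h1 : ∀ a b, K.s a b / ((z - σ a) * (z - σ b)) =
        K.s a b / (σ a - σ b) * (z - σ a)⁻¹ + K.s b a / (σ b - σ a) * (z - σ b)⁻¹ := by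
      intro a b
      by_cases hab : a = b
      · simp [hab, s_self]
      have h2 := sub_ne_zero.mpr (hz a)
      have h3 := sub_ne_zero.mpr (hz b)
      have h4 := sub_ne_zero.mpr (h.1.ne hab)
      rw [← neg_sub (σ a) (σ b), K.s_symm b a]
      field_simp
      ring
    simp only [h1, Finset.sum_add_distrib]
    rw [Finset.sum_comm (f := fun a b => K.s b a / (σ b - σ a) * (z - σ b)⁻¹)]
    simp [← Finset.sum_mul, h.sum_eq_zero]
  have hsym : ∀ A : Fin n → Fin n → ℂ, ∑ a, ∑ b, (A a b - A b a) = 0 := fun A => by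
    simp only [Finset.sum_sub_distrib]
    rw [Finset.sum_comm, sub_self]
  -- The remainder beyond the `s_ab` term is antisymmetric in `a, b` and drops out of the double
  -- sum.
  have key : ∀ a b, K.lam a 0 * K.lamT a 0 / (z - σ a) * (K.lam b 1 * K.lamT b 1 / (z - σ b)) -
      K.lam a 0 * K.lamT a 1 / (z - σ a) * (K.lam b 1 * K.lamT b 0 / (z - σ b)) =
      (1 / 2) * (K.s a b / ((z - σ a) * (z - σ b))) +
      ((1 / 2) * K.lam a 0 * K.lam b 1 * (K.lamT a 0 * K.lamT b 1 - K.lamT a 1 * K.lamT b 0) /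
          ((z - σ a) * (z - σ b)) -
        (1 / 2) * K.lam b 0 * K.lam a 1 * (K.lamT b 0 * K.lamT a 1 - K.lamT b 1 * K.lamT a 0) /
          ((z - σ b) * (z - σ a))) := fun a b => by
    rw [s_eq, angle, square, mul_comm (z - σ b)]
    have h2 := sub_ne_zero.mpr (hz a)
    have h3 := sub_ne_zero.mpr (hz b)
    field_simp
    ring
  rw [Finset.sum_mul_sum, Finset.sum_mul_sum, ← Finset.sum_sub_distrib]
  simp only [← Finset.sum_sub_distrib, key]
  simp only [Finset.sum_add_distrib, ← Finset.mul_sum, hs]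
  rw [hsym (fun a b => (1 / 2) * K.lam a 0 * K.lam b 1 *
    (K.lamT a 0 * K.lamT b 1 - K.lamT a 1 * K.lamT b 0) / ((z - σ a) * (z - σ b)))]
  ring

theorem IsSolution.det_momentumPoly {K : Kinematics n} {σ : Fin n → ℂ} (h : K.IsSolution σ) :
    K.momentumPoly σ 0 0 * K.momentumPoly σ 1 1 =
      K.momentumPoly σ 0 1 * K.momentumPoly σ 1 0 := by
  refine Polynomial.funext fun z => ?_
  by_cases hz : ∃ a, z = σ a
  · obtain ⟨a, rfl⟩ := hz
    simp only [eval_mul, momentumPoly, residuePoly_eval_node]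
    ring
  · push Not at hz
    simp only [eval_mul, momentumPoly, residuePoly_eval_of_ne _ _ hz]
    linear_combination ((nodal Finset.univ σ).eval z) ^ 2 * h.det_eval_eq_zero hz

end Kinematics

/-! ### The kernel of `Φ` and the consequences of nondegeneracy. -/

theorem cubic_coeff_eq_zero {F : Type*} [Field F] {n : ℕ} (hn : 4 ≤ n) {σ : Fin n → F}
    (hσ : Function.Injective σ) {c₀ c₁ c₂ c₃ : F}
    (h : ∀ a, c₀ + c₁ * σ a + c₂ * σ a ^ 2 + c₃ * σ a ^ 3 = 0) :
    c₀ = 0 ∧ c₁ = 0 ∧ c₂ = 0 ∧ c₃ = 0 := by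
  have hp : (⟨c₃, c₂, c₁, c₀⟩ : Cubic F).toPoly = 0 := by
    refine eq_of_eval_node_eq hσ ?_ (by simp) fun a => ?_
    -- Four distinct nodes are what excludes a nonzero cubic.
    · refine lt_of_le_of_lt Polynomial.degree_cubic_le ?_
      exact_mod_cast hn
    · simp only [Cubic.toPoly, eval_add, eval_mul, eval_C, eval_pow, eval_X, eval_zero]
      linear_combination h a
  rw [Cubic.toPoly_eq_zero_iff] at hp
  have := (Cubic.ext_iff).mp hp
  exact ⟨this.2.2.2, this.2.2.1, this.2.1, this.1⟩

namespace Kinematics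

variable {n : ℕ}

theorem Phi_mulVec (K : Kinematics n) (σ u : Fin n → ℂ) (a : Fin n) :
    (K.Phi σ).mulVec u a = ∑ b, K.s a b * (u b - u a) / (σ a - σ b) ^ 2 := by
  rw [Matrix.mulVec, dotProduct, ← Finset.add_sum_erase _ _ (Finset.mem_univ a),
    ← Finset.add_sum_erase _ _ (Finset.mem_univ a), s_self, zero_mul, zero_div, zero_add]
  simp only [Phi, Matrix.of_apply, if_true]
  rw [neg_mul, Finset.sum_mul, neg_add_eq_sub, ← Finset.sum_sub_distrib]
  refine Finset.sum_congr rfl fun b hb => ?_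
  rw [if_neg (Finset.ne_of_mem_erase hb).symm]
  ring

variable {K : Kinematics n} {σ : Fin n → ℂ}

/-- A vector is annihilated by `Φ` if its divided differences are `A_a / σ_ab` up to a term that
drops out of `∑ s_ab (·)`. -/
theorem IsSolution.Phi_mulVec_eq_zero (h : K.IsSolution σ) {u : Fin n → ℂ} {A : Fin n → ℂ}
    {B : Fin n → Fin n → ℂ}
    (hu : ∀ a b, a ≠ b → (u b - u a) = A a * (σ a - σ b) + B a b * (σ a - σ b) ^ 2)
    (hB : ∀ a, ∑ b, B a b * K.s a b = 0) : (K.Phi σ).mulVec u = 0 := by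
  funext a
  have h1 : ∀ b, K.s a b * (u b - u a) / (σ a - σ b) ^ 2 =
      A a * (K.s a b / (σ a - σ b)) + B a b * K.s a b := by
    intro b
    by_cases hab : a = b
    · simp [← hab, s_self]
    have := sub_ne_zero.mpr (h.1.ne hab)
    rw [hu a b hab]
    field_simp
  rw [Phi_mulVec, Finset.sum_congr rfl fun b _ => h1 b, Finset.sum_add_distrib, ← Finset.mul_sum,
    h.sum_eq_zero, hB, mul_zero, add_zero, Pi.zero_apply]

theorem sum_s_eq_zero_of_conservation (K : Kinematics n) (a : Fin n) : ∑ b, K.s a b = 0 := by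
  simpa using K.sum_s_eq_zero (c := fun _ => 1) (by simpa using K.sum_lam_mul_lamT) a

/-- A vector in the kernel of `Φ` is a combination of `1, σ, σ²` if `σ` is nondegenerate. -/
theorem IsSolution.exists_relation (h : K.IsSolution σ) (hnd : K.IsNondegenerate σ)
    {u : Fin n → ℂ} (hu : (K.Phi σ).mulVec u = 0) :
    ∃ c : Fin 4 → ℂ, c ≠ 0 ∧ ∀ a, c 0 + c 1 * σ a + c 2 * σ a ^ 2 + c 3 * u a = 0 := by
  have h0 : (K.Phi σ).mulVec (fun _ => 1) = 0 :=
    h.Phi_mulVec_eq_zero (A := 0) (B := 0) (by simp) (by simp)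
  have h1 : (K.Phi σ).mulVec σ = 0 :=
    h.Phi_mulVec_eq_zero (A := -1) (B := 0) (fun a b _ => by simp) (by simp)
  have h2 : (K.Phi σ).mulVec (fun a => σ a ^ 2) = 0 :=
    h.Phi_mulVec_eq_zero (A := fun a => -2 * σ a) (B := fun _ _ => 1) (fun a b _ => by ring)
      (fun a => by simpa using K.sum_s_eq_zero_of_conservation a)
  -- Four coefficients map linearly into a kernel of dimension `3`, so some nonzero choice maps to
  -- zero.
  let Ψ : (Fin 4 → ℂ) →ₗ[ℂ] LinearMap.ker (K.Phi σ).mulVecLin :=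
    LinearMap.codRestrict _ (Fintype.linearCombination ℂ ![fun _ => 1, σ, fun a => σ a ^ 2, u])
      fun c => by
        rw [Fintype.linearCombination_apply]
        refine Submodule.sum_mem _ fun i _ => Submodule.smul_mem _ _ ?_
        rw [LinearMap.mem_ker, Matrix.mulVecLin_apply]
        fin_cases i <;> simp [h0, h1, h2, hu]
  have hdim := LinearMap.finrank_range_add_finrank_ker (K.Phi σ).mulVecLin
  rw [Module.finrank_fin_fun] at hdim
  rw [IsNondegenerate, Matrix.rank] at hnd
  have hlt : Module.finrank ℂ (LinearMap.ker (K.Phi σ).mulVecLin) <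
      Module.finrank ℂ (Fin 4 → ℂ) := by
    rw [Module.finrank_fin_fun]
    omega
  obtain ⟨c, hc, hc0⟩ := Submodule.exists_mem_ne_zero_of_ne_bot
    (LinearMap.ker_ne_bot_of_finrank_lt (f := Ψ) hlt)
  refine ⟨c, hc0, fun a => ?_⟩
  have := congrFun (congrArg Subtype.val (LinearMap.mem_ker.mp hc)) a
  simpa [Ψ, Fintype.linearCombination_apply, Fin.sum_univ_four] using this

/-- Excludes a zero of `P` at infinity beyond the one due to conservation: `∑ σ_a k_a = 0` would put
`σ³` into the kernel of `Φ`. -/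
theorem IsSolution.exists_first_moment_ne_zero (hn : 4 ≤ n) (h : K.IsSolution σ)
    (hnd : K.IsNondegenerate σ) : ∃ i j, ∑ a, σ a * (K.lam a i * K.lamT a j) ≠ 0 := by
  by_contra! hz
  have hu : (K.Phi σ).mulVec (fun a => σ a ^ 3) = 0 := by
    refine h.Phi_mulVec_eq_zero (A := fun a => -3 * σ a ^ 2) (B := fun a b => 2 * σ a + σ b)
      (fun a b _ => by ring) fun a => ?_
    simp only [add_mul, Finset.sum_add_distrib, ← Finset.mul_sum,
      K.sum_s_eq_zero_of_conservation, K.sum_s_eq_zero hz, mul_zero, add_zero]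
  obtain ⟨c, hc, hrel⟩ := h.exists_relation hnd hu
  obtain ⟨e0, e1, e2, e3⟩ := cubic_coeff_eq_zero hn h.1 hrel
  exact hc (funext fun i => by fin_cases i <;> assumption)

/-- The counterpart at a finite point `z`, with `1 / (z - σ_a)` as the fourth kernel vector. -/
theorem IsSolution.exists_sum_div_ne_zero (hn : 4 ≤ n) (h : K.IsSolution σ)
    (hnd : K.IsNondegenerate σ) {z : ℂ} (hz : ∀ a, z ≠ σ a) :
    ∃ i j, ∑ a, K.lam a i * K.lamT a j / (z - σ a) ≠ 0 := by
  by_contra! hzero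
  have hne : ∀ a, z - σ a ≠ 0 := fun a => sub_ne_zero.mpr (hz a)
  have hu : (K.Phi σ).mulVec (fun a => (z - σ a)⁻¹) = 0 := by
    refine h.Phi_mulVec_eq_zero (A := fun a => -((z - σ a) ^ 2)⁻¹)
      (B := fun a b => ((z - σ a) ^ 2)⁻¹ * (z - σ b)⁻¹) (fun a b _ => ?_) fun a => ?_
    · have h1 := hne a
      have h2 := hne b
      field_simp
      ring
    · simp only [mul_assoc, ← Finset.mul_sum]
      rw [K.sum_s_eq_zero (c := fun b => (z - σ b)⁻¹), mul_zero]
      intro i j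
      simpa only [div_eq_inv_mul] using hzero i j
  obtain ⟨c, hc, hrel⟩ := h.exists_relation hnd hu
  -- The relation multiplied by `z - σ_a` is a cubic in `σ_a`.
  have hcub := cubic_coeff_eq_zero hn h.1 (c₀ := c 0 * z + c 3) (c₁ := c 1 * z - c 0)
    (c₂ := c 2 * z - c 1) (c₃ := -c 2) fun a => by
      have h1 := hne a
      have h2 := hrel a
      field_simp at h2
      linear_combination h2
  obtain ⟨e0, e1, e2, e3⟩ := hcub
  have c2 : c 2 = 0 := neg_eq_zero.mp e3
  have c1 : c 1 = 0 := by linear_combination z * c2 - e2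
  have c0 : c 0 = 0 := by linear_combination z * c1 - e1
  have c3 : c 3 = 0 := by linear_combination e0 - z * c0
  exact hc (funext fun i => by fin_cases i <;> assumption)

end Kinematics

/-! ### Factorization of the momentum polynomial and the two ranks. -/

theorem rank_neg {m n R : Type*} [Fintype n] [CommRing R] [IsDomain R] (A : Matrix m n R) :
    (-A).rank = A.rank := by
  rw [← neg_one_smul R A]
  exact Matrix.rank_smul_of_mem_nonZeroDivisors A
    (mem_nonZeroDivisors_of_ne_zero (neg_ne_zero.mpr one_ne_zero))

/-- A `2 × 2` matrix of polynomials of vanishing determinant is a column times a row, and the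
column can be taken coprime. -/
theorem exists_rank_one_factorization {F : Type*} [Field F] {P : Fin 2 → Fin 2 → F[X]}
    (hdet : P 0 0 * P 1 1 = P 0 1 * P 1 0) {q : Fin 2 → F}
    (hq : ∃ i, P i 1 * C (q 0) - P i 0 * C (q 1) ≠ 0) :
    ∃ L N : Fin 2 → F[X], IsCoprime (L 0) (L 1) ∧ ∀ i j, P i j = L i * N j := by
  let := UniqueFactorizationMonoid.toGCDMonoid F[X]
  set u : Fin 2 → F[X] := fun i => P i 1 * C (q 0) - P i 0 * C (q 1) with hu
  -- The coprime column is a nonzero contraction of the columns of `P` divided by its gcd; `det P =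
  -- 0` makes every column of `P` proportional to it.
  obtain ⟨x, y, hx, hy, hxy⟩ := extract_gcd (u 0) (u 1)
  have hg : gcd (u 0) (u 1) ≠ 0 := fun h => by
    rw [gcd_eq_zero_iff] at h
    obtain ⟨i, hi⟩ := hq
    fin_cases i
    exacts [hi h.1, hi h.2]
  have hcop : IsCoprime x y := (gcd_isUnit_iff_isRelPrime.mp hxy).isCoprime
  have hpar : ∀ j, x * P 1 j = y * P 0 j := by
    intro j
    refine mul_left_cancel₀ hg ?_
    rw [← mul_assoc, ← mul_assoc, ← hx, ← hy]
    fin_cases j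
    · simp only [hu, Fin.zero_eta, Fin.isValue]
      linear_combination -C (q 0) * hdet
    · simp only [hu, Fin.mk_one, Fin.isValue]
      linear_combination -C (q 1) * hdet
  choose N hN using fun j => exists_eq_mul_of_isCoprime (L := ![x, y]) (Q := fun i => P i j)
    (by simpa using hcop) (by simpa using hpar j)
  exact ⟨![x, y], N, by simpa using hcop, fun i j => hN j i⟩

theorem exists_max_natDegree {F : Type*} [Field F] {L : Fin 2 → F[X]}
    (hL : IsCoprime (L 0) (L 1)) :
    ∃ i, L i ≠ 0 ∧ ∀ j, (L j).natDegree ≤ (L i).natDegree := by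
  -- Maximizing `degree` rather than `natDegree` rules out the zero polynomial in a tie with a
  -- constant.
  obtain ⟨i, hi⟩ := Finite.exists_max fun i => (L i).degree
  refine ⟨i, fun h => ?_, fun j => natDegree_le_natDegree (hi j)⟩
  have h0 : ∀ j, L j = 0 := fun j => by simpa [h] using hi j
  obtain ⟨u, v, huv⟩ := hL
  simp [h0] at huv

namespace Kinematics

variable {n : ℕ} {K : Kinematics n} {σ : Fin n → ℂ}

/-- The momentum polynomial of a nondegenerate solution is `L N`, with coprime columns `L` and `N`
of degrees adding up to `n - 2`. -/
theorem IsSolution.exists_factorization (hn : 4 ≤ n) (h : K.IsSolution σ)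
    (hnd : K.IsNondegenerate σ) (hlam : ∀ a, ∃ i, K.lam a i ≠ 0) {q : Fin 2 → ℂ}
    (hq : ∀ a, square (K.lamT a) q ≠ 0) :
    ∃ L N : Fin 2 → ℂ[X], IsCoprime (L 0) (L 1) ∧ IsCoprime (N 0) (N 1) ∧
      (∀ i j, K.momentumPoly σ i j = L i * N j) ∧
      ∃ i j, (∀ k, (L k).natDegree ≤ (L i).natDegree) ∧ (∀ k, (N k).natDegree ≤ (N j).natDegree) ∧
        (L i).natDegree + (N j).natDegree + 2 = n := by
  have hw := nodeWeight_ne_zero h.1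
  have hev : ∀ i j a, (K.momentumPoly σ i j).eval (σ a) =
      K.lam a i * K.lamT a j * nodeWeight σ a := fun i j a => residuePoly_eval_node _ _ _
  obtain ⟨L, N, hL, hLN⟩ := exists_rank_one_factorization (q := q) h.det_momentumPoly (by
    obtain ⟨i, hi⟩ := hlam ⟨0, by omega⟩
    refine ⟨i, fun h0 => ?_⟩
    have h1 := congrArg (eval (σ ⟨0, by omega⟩)) h0
    simp only [eval_sub, eval_mul, eval_C, hev, eval_zero] at h1
    refine mul_ne_zero (mul_ne_zero hi (hq ⟨0, by omega⟩)) (hw ⟨0, by omega⟩) ?_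
    rw [← h1, square]
    ring)
  -- A common zero of `N` annihilates all of `P`. At a puncture this would force `|a] = 0`;
  -- elsewhere nondegeneracy forbids it.
  have hN : IsCoprime (N 0) (N 1) := by
    rw [isCoprime_iff_aeval_ne_zero_of_isAlgClosed ℂ ℂ]
    intro z
    by_contra! hz
    simp only [coe_aeval_eq_eval] at hz
    have hz' : ∀ i j, (K.momentumPoly σ i j).eval z = 0 := fun i j => by
      rw [hLN, eval_mul]
      fin_cases j <;> simp [hz]
    by_cases hzσ : ∃ a, z = σ a
    · obtain ⟨a, rfl⟩ := hzσ
      obtain ⟨i, hi⟩ := hlam a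
      have h0 : ∀ j, K.lamT a j = 0 := fun j => by
        have := hz' i j
        rw [hev] at this
        simpa [hi, hw] using this
      exact hq a (by simp [square, h0])
    · push Not at hzσ
      obtain ⟨i, j, hij⟩ := h.exists_sum_div_ne_zero hn hnd hzσ
      have h1 := hz' i j
      rw [momentumPoly, residuePoly_eval_of_ne _ _ hzσ, mul_eq_zero] at h1
      exact h1.elim (eval_nodal_not_at_node fun a _ => hzσ a) hij
  refine ⟨L, N, hL, hN, hLN, ?_⟩
  obtain ⟨i, hi0, hi⟩ := exists_max_natDegree hL
  obtain ⟨j, hj0, hj⟩ := exists_max_natDegree hN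
  refine ⟨i, j, hi, hj, ?_⟩
  have hle : (L i).natDegree + (N j).natDegree ≤ n - 2 := by
    rw [← natDegree_mul hi0 hj0, ← hLN]
    exact residuePoly_natDegree_le (K.sum_lam_mul_lamT i j)
  -- The first moment is the coefficient of `z ^ (n - 2)`, so its nonvanishing makes the degree
  -- bound sharp.
  obtain ⟨i', j', hij⟩ := h.exists_first_moment_ne_zero hn hnd
  rw [← residuePoly_coeff_of_sum_eq_zero (by omega) (K.sum_lam_mul_lamT i' j')] at hij
  have hge : n - 2 ≤ (K.momentumPoly σ i' j').natDegree := le_natDegree_of_ne_zero hij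
  rw [hLN] at hge
  have := natDegree_mul_le (p := L i') (q := N j')
  have := hi i'
  have := hj j'
  omega

theorem exists_lam_ne_zero {p : Fin 2 → ℂ} (hp : ∀ a, angle (K.lam a) p ≠ 0) (a : Fin n) :
    ∃ i, K.lam a i ≠ 0 := by
  by_contra! h0
  exact hp a (by simp [angle, h0])

theorem exists_lamT_ne_zero {q : Fin 2 → ℂ} (hq : ∀ a, square (K.lamT a) q ≠ 0) (a : Fin n) :
    ∃ i, K.lamT a i ≠ 0 := by
  by_contra! h0
  exact hq a (by simp [square, h0])

/-- The ranks of the discriminant matrices do not depend on the reference spinors, and add up to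
`n - 2`. -/
theorem IsSolution.exists_ranks (hn : 4 ≤ n) (h : K.IsSolution σ) (hnd : K.IsNondegenerate σ)
    {p₀ q₀ : Fin 2 → ℂ} (hp₀ : ∀ a, angle (K.lam a) p₀ ≠ 0)
    (hq₀ : ∀ a, square (K.lamT a) q₀ ≠ 0) :
    ∃ d d', d + d' + 2 = n ∧
      (∀ q, (∀ a, square (K.lamT a) q ≠ 0) → (K.discMinus q σ).rank = d) ∧
      ∀ p, (∀ a, angle (K.lam a) p ≠ 0) → (K.discPlus p σ).rank = d' := by
  have hlam := exists_lam_ne_zero hp₀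
  obtain ⟨L, N, hL, hN, hLN, i, j, hi, hj, hd⟩ := h.exists_factorization hn hnd hlam hq₀
  refine ⟨_, _, hd, fun q hq => ?_, fun p hp => ?_⟩
  · exact rank_discriminant h.1 hL hLN (by omega) hi ⟨i, rfl⟩ hlam hq fun a b => rfl
  -- `square` is minus `angle`, so `-ℭ₊` has the form of `ℭ₋` with the two kinds of spinors, and `L`
  -- and `N`, exchanged.
  · rw [← rank_neg]
    have hsq : ∀ x y, square x y = -angle x y := fun x y => by
      simp only [square, angle]
      ring
    refine rank_discriminant (L := N) (N := L) (y := K.lam) (q := p) h.1 hN (fun i j => ?_)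
      (by omega) hj ⟨j, rfl⟩ (exists_lamT_ne_zero hq₀) (fun a => ?_) fun a b => ?_
    · rw [mul_comm, ← hLN, momentumPoly]
      simp only [mul_comm]
    · rw [hsq]
      exact neg_ne_zero.mpr (hp a)
    · rw [Matrix.neg_apply, discPlus, Matrix.of_apply]
      split_ifs with hab
      · simp only [hsq, mul_neg, neg_mul, neg_div, div_neg, Finset.sum_neg_distrib, neg_neg]
      · rw [hsq]
        ring

/-- Serves to keep both ranks positive, so that `rank = m + 1` with natural `m` misses no solution:
a zero discriminant matrix would make every `s_ab` vanish, hence `Φ`, whose rank is `n - 3 ≥ 1`. -/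
theorem IsNondegenerate.exists_s_ne_zero (hn : 4 ≤ n) (hnd : K.IsNondegenerate σ) :
    ∃ a b, a ≠ b ∧ K.s a b ≠ 0 := by
  by_contra! h0
  have : K.Phi σ = 0 := by
    ext a b
    have hs : ∀ c, K.s a c = 0 := fun c => by
      by_cases hac : a = c
      · rw [hac, s_self]
      · exact h0 a c hac
    simp [Phi, hs]
  rw [IsNondegenerate, this, Matrix.rank_zero] at hnd
  omega

theorem eq_zero_of_rank_eq_zero {A : Matrix (Fin n) (Fin n) ℂ} (h : A.rank = 0) : A = 0 := by
  rw [Matrix.rank, Submodule.finrank_eq_zero, LinearMap.range_eq_bot] at h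
  exact Matrix.toLin'.injective (by simpa [Matrix.toLin'_apply'] using h)

theorem IsSolution.rank_discMinus_ne_zero (hn : 4 ≤ n) (h : K.IsSolution σ)
    (hnd : K.IsNondegenerate σ) (q : Fin 2 → ℂ) : (K.discMinus q σ).rank ≠ 0 := fun h0 => by
  obtain ⟨a, b, hab, hs⟩ := hnd.exists_s_ne_zero hn
  have h1 := congrFun (congrFun (eq_zero_of_rank_eq_zero h0) a) b
  simp only [discMinus, Matrix.of_apply, if_neg hab, Matrix.zero_apply, div_eq_zero_iff,
    sub_ne_zero.mpr (h.1.ne hab), or_false] at h1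
  exact hs (by rw [s_eq, h1, zero_mul, neg_zero])

theorem IsSolution.rank_discPlus_ne_zero (hn : 4 ≤ n) (h : K.IsSolution σ)
    (hnd : K.IsNondegenerate σ) (p : Fin 2 → ℂ) : (K.discPlus p σ).rank ≠ 0 := fun h0 => by
  obtain ⟨a, b, hab, hs⟩ := hnd.exists_s_ne_zero hn
  have h1 := congrFun (congrFun (eq_zero_of_rank_eq_zero h0) a) b
  simp only [discPlus, Matrix.of_apply, if_neg hab, Matrix.zero_apply, div_eq_zero_iff,
    sub_ne_zero.mpr (h.1.ne hab), or_false] at h1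
  exact hs (by rw [s_eq, h1, mul_zero, neg_zero])

/-! ### Real momenta and complex conjugation. -/

open ComplexConjugate

/-- A real momentum has a Hermitian bispinor. -/
theorem IsReal.conj_mul (hK : K.IsReal) (a : Fin n) (i j : Fin 2) :
    conj (K.lam a i) * conj (K.lamT a j) = K.lam a j * K.lamT a i := by
  have h : ∀ μ, conj (K.mom a μ) = K.mom a μ := fun μ => Complex.conj_eq_iff_im.mpr (hK a μ)
  have h0 := h 0
  have h1 := h 1
  have h2 := h 2
  have h3 := h 3
  simp only [mom, momentum, Matrix.cons_val, map_div₀, map_add, map_sub, map_mul, Complex.conj_I,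
    map_ofNat] at h0 h1 h2 h3
  set x := K.lam a
  set y := K.lamT a
  fin_cases i <;> fin_cases j <;> simp only [Fin.zero_eta, Fin.mk_one, Fin.isValue]
  · linear_combination h0 + h3
  · linear_combination h1 + Complex.I * h2 + (1 / 2) * (conj (x 0) * conj (y 1) -
      conj (x 1) * conj (y 0) + x 0 * y 1 - x 1 * y 0) * Complex.I_sq
  · linear_combination h1 - Complex.I * h2 - (1 / 2) * (conj (x 0) * conj (y 1) -
      conj (x 1) * conj (y 0) + x 0 * y 1 - x 1 * y 0) * Complex.I_sq
  · linear_combination h0 - h3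

/-- A nonzero Hermitian matrix of rank one is a real multiple of `v v†`; the sign of `c a` is left
free. -/
theorem IsReal.exists_lamT_eq (hK : K.IsReal) (hlam : ∀ a, ∃ i, K.lam a i ≠ 0)
    (hlamT : ∀ a, ∃ i, K.lamT a i ≠ 0) :
    ∃ c : Fin n → ℂ, (∀ a, c a ≠ 0) ∧ (∀ a, conj (c a) = c a) ∧
      ∀ a j, K.lamT a j = c a * conj (K.lam a j) := by
  choose i hi using hlam
  have hc : ∀ a j, K.lamT a j = conj (K.lamT a (i a)) / K.lam a (i a) * conj (K.lam a j) := by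
    intro a j
    have := hi a
    have h1 := hK.conj_mul a j (i a)
    field_simp
    linear_combination -h1
  refine ⟨fun a => conj (K.lamT a (i a)) / K.lam a (i a), fun a h0 => ?_, fun a => ?_, hc⟩
  · obtain ⟨j, hj⟩ := hlamT a
    exact hj (by rw [hc]; exact mul_eq_zero_of_left h0 _)
  · have h1 := hi a
    have h2 : conj (K.lam a (i a)) ≠ 0 := (_root_.map_ne_zero _).mpr h1
    have h3 := hK.conj_mul a (i a) (i a)
    rw [map_div₀, Complex.conj_conj, div_eq_div_iff h2 h1]
    linear_combination -h3

theorem IsReal.conj_s (hK : K.IsReal) (a b : Fin n) : conj (K.s a b) = K.s a b := by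
  have h : ∀ a μ, conj (K.mom a μ) = K.mom a μ := fun a μ =>
    Complex.conj_eq_iff_im.mpr (hK a μ)
  simp only [s, minkowski, map_mul, map_sub, map_ofNat, h]

theorem IsReal.isSolution_conj (hK : K.IsReal) (h : K.IsSolution σ) :
    K.IsSolution fun a => conj (σ a) := by
  refine ⟨fun a b hab => h.1 ((starRingEnd ℂ).injective hab), fun a => ?_⟩
  have := congrArg conj (h.2 a)
  simpa [map_sum, hK.conj_s] using this

-- Up to sign, `ℭ₊` at the conjugate punctures is the entrywise conjugate of `ℭ₋(σ)` multiplied by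
-- `diag c` on both sides. On the diagonal one factor `c a` cancels against the reference-spinor
-- ratio, which needs the conjugate of `p` in place of `q`.
open ComplexOrder in
theorem IsReal.rank_discPlus_conj (hK : K.IsReal) (hlam : ∀ a, ∃ i, K.lam a i ≠ 0)
    (hlamT : ∀ a, ∃ i, K.lamT a i ≠ 0) (p : Fin 2 → ℂ) :
    (K.discPlus p fun a => conj (σ a)).rank = (K.discMinus (fun i => conj (p i)) σ).rank := by
  obtain ⟨c, hc0, hc, hT⟩ := hK.exists_lamT_eq hlam hlamT
  have hdet : (Matrix.diagonal c).det ≠ 0 := by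
    rw [Matrix.det_diagonal]
    exact Finset.prod_ne_zero_iff.mpr fun a _ => hc0 a
  have key : -K.discPlus p (fun a => conj (σ a)) =
      Matrix.diagonal c * (K.discMinus (fun i => conj (p i)) σ).conjTranspose.transpose *
        Matrix.diagonal c := by
    ext a b
    rw [Matrix.mul_diagonal, Matrix.diagonal_mul, Matrix.transpose_apply,
      Matrix.conjTranspose_apply, Matrix.neg_apply]
    simp only [discPlus, discMinus, Matrix.of_apply]
    split_ifs with hab
    · subst hab
      rw [Complex.star_def, map_neg, map_sum, neg_neg, mul_neg, neg_mul, Finset.mul_sum,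
        Finset.sum_mul, ← Finset.sum_neg_distrib]
      refine Finset.sum_congr rfl fun d _ => ?_
      have h1 := hc0 a
      have h2 : square (K.lamT a) (K.lamT d) =
          -(c a * c d * conj (angle (K.lam a) (K.lam d))) := by
        simp only [square, angle, hT, map_sub, map_mul]
        ring
      have h3 : ∀ d, conj (square (K.lamT d) fun i => conj (p i)) =
          -(c d * angle (K.lam d) p) := fun d => by
        simp only [square, angle, hT, map_sub, map_mul, Complex.conj_conj, hc]
        ring
      simp only [map_div₀, map_mul, map_sub, h2, h3]
      rw [mul_neg, mul_neg, neg_div_neg_eq, mul_left_comm _ (c a) (angle (K.lam a) p)]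
      field_simp
    · rw [Complex.star_def, map_div₀, map_sub]
      simp only [square, angle, hT, map_sub, map_mul]
      ring
  rw [← rank_neg, key, Matrix.rank_mul_eq_left_of_det_ne_zero _ _ hdet,
    Matrix.rank_mul_eq_right_of_det_ne_zero _ _ hdet, Matrix.rank_transpose,
    Matrix.rank_conjTranspose]

end Kinematics

/-! ### Conjugation on Möbius classes. -/

open ComplexConjugate in
theorem mobiusSetoid_conj {n : ℕ} {σ τ : Fin n → ℂ} (h : (mobiusSetoid n).r σ τ) :
    (mobiusSetoid n).r (fun a => conj (σ a)) (fun a => conj (τ a)) := by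
  obtain ⟨g, hg⟩ := h
  refine ⟨g.map (starRingEnd ℂ), fun a => ?_⟩
  have := OnePoint.map_smul (starRingEnd ℂ) g (σ a)
  rw [hg a] at this
  simpa using this.symm

/-- Complex conjugation of Möbius classes. -/
def conjClass {n : ℕ} : Quotient (mobiusSetoid n) → Quotient (mobiusSetoid n) :=
  Quotient.map (fun σ a => (starRingEnd ℂ) (σ a)) fun _ _ => mobiusSetoid_conj

theorem conjClass_involutive {n : ℕ} : Function.Involutive (conjClass (n := n)) := by
  rintro ⟨σ⟩
  change Quotient.mk _ _ = Quotient.mk _ _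
  simp

theorem mobiusClasses_conjSet {n : ℕ} (P : Set (Fin n → ℂ)) :
    mobiusClasses (conjSet P) = conjClass '' mobiusClasses P := by
  rw [mobiusClasses, mobiusClasses, conjSet, Set.image_image, Set.image_image]
  rfl

theorem conjSet_conjSet {n : ℕ} (P : Set (Fin n → ℂ)) : conjSet (conjSet P) = P := by
  simp [conjSet, Set.image_image]

end CHY

/-! ### Assembly of the statements from the rank sum. -/

theorem mainTheorem2 (n : ℕ) (hn : 4 ≤ n) (K : CHY.Kinematics n)
    (hK : ∀ σ, K.IsSolution σ → K.IsNondegenerate σ)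
    (p q : Fin 2 → ℂ)
    (hp : ∀ a, CHY.angle (K.lam a) p ≠ 0) (hq : ∀ a, CHY.square (K.lamT a) q ≠ 0) :
    (∀ σ, K.IsSolution σ → ∃ m, m ≤ n - 4 ∧ σ ∈ K.PMinus q m) ∧
    (∀ m, ∀ σ ∈ K.PMinus q m,
      m ≤ n - 4 ∧
      (K.discMinus q σ).rank = m + 1 ∧
      (K.discPlus p σ).rank = n - m - 3 ∧
      (K.discMinus q σ).rank + (K.discPlus p σ).rank = n - 2) ∧
    (∀ k, k ≤ n - 4 → K.PPlus p (n - k - 4) = K.PMinus q k) ∧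
    (K.IsReal → ∀ k, k ≤ n - 4 →
      K.PPlus p (n - k - 4) = CHY.conjSet (K.PMinus q (n - k - 4)) ∧
      CHY.conjSet (K.PMinus q (n - k - 4)) = K.PMinus q k ∧
      CHY.conjSet (K.PMinus q k) = K.PMinus q (n - k - 4) ∧
      Cardinal.mk (CHY.mobiusClasses (K.PMinus q k)) =
        Cardinal.mk (CHY.mobiusClasses (K.PMinus q (n - k - 4)))) := by
  have hsum : ∀ σ, K.IsSolution σ →
      (K.discMinus q σ).rank + (K.discPlus p σ).rank + 2 = n := fun σ h => by
    obtain ⟨d, d', hd, hm, hpl⟩ := h.exists_ranks hn (hK σ h) hp hq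
    rw [hm q hq, hpl p hp, hd]
  have hm0 := fun σ (h : K.IsSolution σ) => h.rank_discMinus_ne_zero hn (hK σ h) q
  have hp0 := fun σ (h : K.IsSolution σ) => h.rank_discPlus_ne_zero hn (hK σ h) p
  have hflip : ∀ k, k ≤ n - 4 → K.PPlus p (n - k - 4) = K.PMinus q k := by
    intro k hk
    ext σ
    refine and_congr_right fun h => ?_
    have := hsum σ h
    omega
  refine ⟨fun σ h => ⟨(K.discMinus q σ).rank - 1, ?_, h, ?_⟩, fun m σ ⟨h, hr⟩ => ?_, hflip,
    fun hreal k hk => ?_⟩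
  · have := hsum σ h
    have := hp0 σ h
    omega
  · have := hm0 σ h
    omega
  · have := hsum σ h
    have := hp0 σ h
    omega
  · have hlam := CHY.Kinematics.exists_lam_ne_zero hp
    have hlamT := CHY.Kinematics.exists_lamT_ne_zero hq
    obtain ⟨c, hc0, hc, hT⟩ := hreal.exists_lamT_eq hlam hlamT
    have hpbar : ∀ a, CHY.square (K.lamT a) (fun i => (starRingEnd ℂ) (p i)) ≠ 0 := fun a h0 => by
      have h1 : CHY.square (K.lamT a) (fun i => (starRingEnd ℂ) (p i)) =
          -(c a * (starRingEnd ℂ) (CHY.angle (K.lam a) p)) := by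
        simp only [CHY.square, CHY.angle, hT, map_sub, map_mul]
        ring
      rw [h1, neg_eq_zero, mul_eq_zero, map_eq_zero] at h0
      exact h0.elim (hc0 a) (hp a)
    -- Conjugation produces the reference spinor `p̄`; independence of the rank from the reference
    -- spinor brings it back to `q`.
    have hrank : ∀ σ, K.IsSolution σ →
        (K.discPlus p fun a => (starRingEnd ℂ) (σ a)).rank = (K.discMinus q σ).rank :=
      fun σ h => by
        obtain ⟨d, d', -, hm, -⟩ := h.exists_ranks hn (hK σ h) hp hq
        rw [hreal.rank_discPlus_conj hlam hlamT, hm _ hpbar, hm q hq]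
    have hconj : ∀ m, CHY.conjSet (K.PMinus q m) = K.PPlus p m := by
      intro m
      ext τ
      constructor
      · rintro ⟨σ, ⟨h, hr⟩, rfl⟩
        exact ⟨hreal.isSolution_conj h, (hrank σ h).trans hr⟩
      · rintro ⟨h, hr⟩
        have h1 := hreal.isSolution_conj h
        have h2 := hrank _ h1
        simp only [Complex.conj_conj] at h2
        exact ⟨_, ⟨h1, h2.symm.trans hr⟩, by simp⟩
    have hA : CHY.conjSet (K.PMinus q (n - k - 4)) = K.PMinus q k := by
      rw [hconj, hflip k hk]
    refine ⟨(hconj _).symm, hA, by rw [← hA, CHY.conjSet_conjSet], ?_⟩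
    -- Conjugation is an injective map of classes, so the cardinals agree without any finiteness of
    -- the solution set.
    rw [← hA, CHY.mobiusClasses_conjSet]
    exact Cardinal.mk_image_eq CHY.conjClass_involutive.injective
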